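/- **Proposition 3.3 (step initial condition, finite time kernel).** *Setting.* Let $a,b:\mathbb R\to\mathbb R$ with $a(t),b(t)$ the integrated right and left jump intensities. For pairs (particle label, time) write $(n_1,t_1)\prec(n_2,t_2)$ if $n_1\le n_2$, $t_2\le t_1$ and the two pairs are not identical; a finite sequence $p_1,\dots,p_m$ of such pairs is a space-like path if $p_i\prec p_j$ for $i<j$. For rates $v_1,v_2,\dots>0$ and initial positions $y_1>y_2>\cdots$ the PushASEP kernel is $$K((n_1,t_1),x_1;(n_2,t_2),x_2)=-\phi^{((n_1,t_1),(n_2,t_2))}(x_1,x_2)+\sum_{k=1}^{n_2}\Psi^{n_1,t_1}_{n_1-k}(x_1)\,\Phi^{n_2,t_2}_{n_2-k}(x_2),$$ where $$\Psi^{n,t}_{n-l}(x)=\frac1{2\pi i}\oint_{\Gamma_0}dz\,z^{x-y_l-1}e^{a(t)/z+b(t)z}\,\frac{(1-v_1z)\cdots(1-v_nz)}{(1-v_1z)\cdots(1-v_lz)},\qquad l\ge 1,$$ $$\phi^{((n_1,t_1),(n_2,t_2))}(x_1,x_2)=\frac1{2\pi i}\oint_{\Gamma_0}\frac{dz}{z^{x_2-x_1+1}}\,\frac{e^{(a(t_1)-a(t_2))/z}e^{(b(t_1)-b(t_2))z}}{(1-v_{n_1+1}z)\cdots(1-v_{n_2}z)}\,\mathbb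 1_{[(n_1,t_1)\prec(n_2,t_2)]},$$ and $\{\Phi^{n,t}_{n-k}\}_{k=1}^n$ are the functions $\mathbb Z\to\mathbb C$ with $\sum_{x\in\mathbb Z}\Psi^{n,t}_{n-l}(x)\Phi^{n,t}_{n-k}(x)=\delta_{k,l}$ for $1\le k,l\le n$, whose span is $V_n=\mathrm{span}\{x^lu^x\}$, with $u$ running over the distinct values of $v_1,\dots,v_n$ and $0\le l<$ multiplicity of $u$. Here $\Gamma_0$ is any closed contour going once anticlockwise around $0$ and not around any pole $1/v_j$. *Claim.* Let $v_k=1$ and $y_k=-k$ for all $k\ge1$. Then for all $n,t$ the family $\{\Phi^{n,t}_{n-k}\}_{k=1}^n$ exists and is unique. Moreover, for any two pairs $(n_1,t_1)$, $(n_2,t_2)$ on a common space-like path (so they are equal, or one of them precedes the other) and all $x_1,x_2\in\mathbb Z$, one has $(-1)^{n_1-n_2}K((n_1,t_1),x_1;(n_2,t_2),x_2)=K^{\rm step}((n_1,t_1),x_1;(n_2,t_2),x_2)$, where $$\begin{aligned}K^{\rm step}((n_1,t_1),x_1;(n_2,t_2),x_2)=&-\frac1{2\pi i}\oint_{\Gamma_0}dw\,\frac1{w^{x_1-x_2+1}}\Big(\frac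 w{1-w}\Big)^{n_2-n_1}\frac{e^{a(t_1)w+b(t_1)/w}}{e^{a(t_2)w+b(t_2)/w}}\,\mathbb 1_{[(n_1,t_1)\prec(n_2,t_2)]}\\&+\frac1{(2\pi i)^2}\oint_{\Gamma_0}dw\oint_{\Gamma_1}dz\,\frac{e^{b(t_1)/w+a(t_1)w}}{e^{b(t_2)/z+a(t_2)z}}\,\frac{(1-w)^{n_1}}{w^{x_1+n_1+1}}\,\frac{z^{x_2+n_2}}{(1-z)^{n_2}}\,\frac1{w-z}.\end{aligned}$$ In the single integral $\Gamma_0$ goes once anticlockwise around $0$ and not around $1$. In the double integral $\Gamma_0$ goes once anticlockwise around $0$ and not around $1$ or any point of $\Gamma_1$, and $\Gamma_1$ goes once anticlockwise around $1$ and not around $0$ or any point of $\Gamma_0$; in particular the two contours are disjoint. Consequently $K$ and $K^{\rm step}$ have the same correlation determinants: for all pairs $p_1,\dots,p_r$ on a common space-like path (repetitions allowed) and all $x_1,\dots,x_r\in\mathbb Z$, $$\det[K(p_\alpha,x_\alpha;p_\beta,x_\beta)]_{1\le\alpha,\beta\le r}=\det[K^{\rm step}(p_\alpha,x_\alpha;p_\beta,x_\beta)]_{1\le\alpha,\beta\le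 r}.$$ -/

import Mathlib

noncomputable section

namespace PushASEP

/-! ### Contours -/

/-- A closed contour in `ℂ`, parametrised by `[0, 1]`: continuous, closed, differentiable
except at finitely many corners, with integrable derivative.  In particular every closed
piecewise `C¹` curve is of this kind. -/
structure Loop where
  path : ℝ → ℂ
  continuousOn_path : ContinuousOn path (Set.Icc 0 1)
  closed : path 0 = path 1
  differentiable_off_corners :
    ∃ S : Finset ℝ, ∀ s ∈ Set.Ioo (0 : ℝ) 1, s ∉ S → DifferentiableAt ℝ path s
  integrable_deriv : IntervalIntegrable (deriv path) MeasureTheory.volume 0 1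

/-- The normalised contour integral `(2πi)⁻¹ ∮_γ f(z) dz`. -/
def Loop.integral (γ : Loop) (f : ℂ → ℂ) : ℂ :=
  (2 * Real.pi * Complex.I)⁻¹ * ∫ s in (0 : ℝ)..1, f (γ.path s) * deriv γ.path s

/-- `γ` avoids the point `p`. -/
def Loop.Avoids (γ : Loop) (p : ℂ) : Prop := ∀ s ∈ Set.Icc (0 : ℝ) 1, γ.path s ≠ p

/-- The winding number of `γ` around `p` (for `γ` avoiding `p`). -/
def Loop.winding (γ : Loop) (p : ℂ) : ℂ := γ.integral (fun z => (z - p)⁻¹)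

/-- `γ` goes around `p` once, anticlockwise.  For an anticlockwise simple loop: `p` lies
inside. -/
def Loop.Includes (γ : Loop) (p : ℂ) : Prop := γ.Avoids p ∧ γ.winding p = 1

/-- `γ` does not go around `p`.  For a simple loop: `p` lies outside. -/
def Loop.Excludes (γ : Loop) (p : ℂ) : Prop := γ.Avoids p ∧ γ.winding p = 0

/-! ### Space-like paths -/

/-- The relation `(n₁,t₁) ≺ (n₂,t₂)` on pairs (particle label, time). -/
def Prec (p q : ℕ × ℝ) : Prop := p.1 ≤ q.1 ∧ q.2 ≤ p.2 ∧ p ≠ q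

/-- A finite sequence of pairs (particle label, time) along a space-like path. -/
def IsSpaceLike {m : ℕ} (p : Fin m → ℕ × ℝ) : Prop := ∀ i j, i < j → Prec (p i) (p j)

/-! ### The kernel of PushASEP for general rates and initial positions

`v k` (`k ≥ 1`) are the rates and `y k` the initial positions of the particles; `a`, `b` are
the time-integrated right and left jump intensities.  `C` is the contour around `0`. -/

/-- `Psi C a b v y n t l` is the function `Ψ^{n,t}_{n-l}` on `ℤ`, where `l ≥ 1` may be larger
than `n`. -/
def Psi (C : Loop) (a b : ℝ → ℝ) (v : ℕ → ℝ) (y : ℕ → ℤ) (n : ℕ) (t : ℝ) (l : ℕ) (x : ℤ) : ℂ :=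
  C.integral fun z =>
    z ^ (x - y l - 1) * Complex.exp (a t / z + b t * z)
      * ((∏ j ∈ Finset.Icc 1 n, (1 - v j * z)) / ∏ j ∈ Finset.Icc 1 l, (1 - v j * z))

/-- The space `V_n`, spanned by the functions `x ↦ x^l u^x`, where `u` runs through the values
of `v_1, …, v_n` and `l` through the nonnegative integers below the multiplicity of `u`. -/
def V (v : ℕ → ℝ) (n : ℕ) : Submodule ℂ (ℤ → ℂ) :=
  Submodule.span ℂ {f | ∃ i ∈ Finset.Icc 1 n,
    ∃ l < ((Finset.Icc 1 n).filter fun j => v j = v i).card,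
      f = fun x : ℤ => (x : ℂ) ^ l * (v i : ℂ) ^ x}

/-- `Φ : Fin n → ℤ → ℂ` is the dual family `{Φ^{n,t}_{n-k}}`, `k = 1, …, n`: it is
biorthonormal to `{Ψ^{n,t}_{n-l}}`, `l = 1, …, n`, and spans `V_n`.  The function
`Φ^{n,t}_{n-k}` is stored at the index `k - 1` of `Fin n`. -/
def IsDualFamily (C : Loop) (a b : ℝ → ℝ) (v : ℕ → ℝ) (y : ℕ → ℤ) (n : ℕ) (t : ℝ)
    (Φ : Fin n → ℤ → ℂ) : Prop :=
  (∀ l k : Fin n,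
    HasSum (fun x : ℤ => Psi C a b v y n t (l + 1) x * Φ k x) (if k = l then 1 else 0)) ∧
  Submodule.span ℂ (Set.range Φ) = V v n

open Classical in
/-- The transition function `φ^{((n₁,t₁),(n₂,t₂))}(x₁,x₂)`. -/
def phi (C : Loop) (a b : ℝ → ℝ) (v : ℕ → ℝ) (p₁ : ℕ × ℝ) (x₁ : ℤ) (p₂ : ℕ × ℝ) (x₂ : ℤ) : ℂ :=
  if Prec p₁ p₂ then
    C.integral fun z =>
      1 / z ^ (x₂ - x₁ + 1)
        * (Complex.exp ((a p₁.2 - a p₂.2) / z) * Complex.exp ((b p₁.2 - b p₂.2) * z)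
          / ∏ j ∈ Finset.Icc (p₁.1 + 1) p₂.1, (1 - v j * z))
  else 0

/-- The kernel `K((n₁,t₁),x₁;(n₂,t₂),x₂)` of PushASEP:
`-φ^{((n₁,t₁),(n₂,t₂))}(x₁,x₂) + ∑_{k=1}^{n₂} Ψ^{n₁,t₁}_{n₁-k}(x₁) Φ^{n₂,t₂}_{n₂-k}(x₂)`,
for given dual families `Φ n t`. -/
def kernel (C : Loop) (a b : ℝ → ℝ) (v : ℕ → ℝ) (y : ℕ → ℤ)
    (Φ : (n : ℕ) → ℝ → Fin n → ℤ → ℂ) (p₁ : ℕ × ℝ) (x₁ : ℤ) (p₂ : ℕ × ℝ) (x₂ : ℤ) : ℂ :=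
  -phi C a b v p₁ x₁ p₂ x₂
    + ∑ k : Fin p₂.1, Psi C a b v y p₁.1 p₁.2 (k + 1) x₁ * Φ p₂.1 p₂.2 k x₂

/-! ### The explicit kernel for uniform rates and step initial condition -/

open Classical in
/-- The explicit kernel: a single integral over `Γ` plus a double integral with `w` on `Γ₀`
and `z` on `Γ₁`. -/
def stepKernel (Γ Γ₀ Γ₁ : Loop) (a b : ℝ → ℝ)
    (p₁ : ℕ × ℝ) (x₁ : ℤ) (p₂ : ℕ × ℝ) (x₂ : ℤ) : ℂ :=
  -(if Prec p₁ p₂ then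
      Γ.integral fun w =>
        1 / w ^ (x₁ - x₂ + 1) * (w / (1 - w)) ^ ((p₂.1 : ℤ) - p₁.1)
          * (Complex.exp (a p₁.2 * w + b p₁.2 / w) / Complex.exp (a p₂.2 * w + b p₂.2 / w))
    else 0)
  + Γ₀.integral fun w => Γ₁.integral fun z =>
      Complex.exp (b p₁.2 / w + a p₁.2 * w) / Complex.exp (b p₂.2 / z + a p₂.2 * z)
        * ((1 - w) ^ p₁.1 / w ^ (x₁ + p₁.1 + 1))
        * (z ^ (x₂ + p₂.1) / (1 - z) ^ p₂.1)
        * (1 / (w - z))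

end PushASEP

end

/-!
For unit rates every contour integral in the problem has an integrand `f z * (z - 1) ^ m` with `f`
holomorphic away from `0`, so it depends on the contour only through its winding numbers around `0`
and `1`. The inversion `z ↦ 1 / z` turns the contour around `0` into one that winds clockwise
around both `0` and `1`, so that `Ψ` and `φ` become sums of an integral along `Γ₀` and one along
`Γ₁`. The dual functions are explicit integrals along `Γ₁`: expanding the integrand of `Ψ` into its
Laurent series shows that they are biorthonormal to the `Ψ`, and integration by parts that they are
polynomials.

In the double integral, `(1 - z)⁻ⁿ (w - z)⁻¹` has a finite expansion in powers of `w - 1` and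
`z - 1` up to a term without pole at `1`; this produces the `Γ₀` part of `∑ Ψ Φ`. The `Γ₁` part of
that sum is a convolution of Taylor coefficients at `1`, hence a single residue at `1`, which
cancels against the `Γ₁` part of `φ` or vanishes when `n₂ ≤ n₁`.
-/

noncomputable section

namespace PushASEP

open MeasureTheory Set

/-! ### Integration along loops -/

/-- The trace of a loop: the set of its points. -/
def Loop.trace (γ : Loop) : Set ℂ := γ.path '' Icc 0 1

namespace Loop

variable (γ : Loop)

theorem path_mem_trace {s : ℝ} (hs : s ∈ Icc (0 : ℝ) 1) : γ.path s ∈ γ.trace :=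
  mem_image_of_mem _ hs

theorem isCompact_trace : IsCompact γ.trace :=
  isCompact_Icc.image_of_continuousOn γ.continuousOn_path

variable {γ} in
theorem Avoids.trace_subset {p : ℂ} (h : γ.Avoids p) : γ.trace ⊆ {p}ᶜ :=
  image_subset_iff.2 h

variable {γ} in
theorem Avoids.sub_ne_zero {p z : ℂ} (h : γ.Avoids p) (hz : z ∈ γ.trace) : z - p ≠ 0 :=
  _root_.sub_ne_zero.2 (h.trace_subset hz)

theorem continuousOn_comp {f : ℂ → ℂ} (hf : ContinuousOn f γ.trace) :
    ContinuousOn (fun s => f (γ.path s)) (Icc 0 1) :=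
  hf.comp γ.continuousOn_path (mapsTo_image _ _)

theorem intervalIntegrable {f : ℂ → ℂ} (hf : ContinuousOn f γ.trace) :
    IntervalIntegrable (fun s => f (γ.path s) * deriv γ.path s) volume 0 1 := by
  refine γ.integrable_deriv.continuousOn_mul ?_
  rw [uIcc_of_le zero_le_one]
  exact γ.continuousOn_comp hf

theorem ae_hasDerivAt_path :
    ∀ᵐ s, s ∈ uIoc (0 : ℝ) 1 → s ∈ Icc (0 : ℝ) 1 ∧ HasDerivAt γ.path (deriv γ.path s) s := by
  obtain ⟨S, hS⟩ := γ.differentiable_off_corners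
  filter_upwards [(insert 1 S).countable_toSet.ae_notMem volume] with s hs hs'
  rw [uIoc_of_le zero_le_one] at hs'
  rw [Finset.mem_coe, Finset.mem_insert, not_or] at hs
  exact ⟨Ioc_subset_Icc_self hs',
    (hS s ⟨hs'.1, lt_of_le_of_ne hs'.2 hs.1⟩ hs.2).hasDerivAt⟩

theorem integral_congr {f g : ℂ → ℂ} (h : EqOn f g γ.trace) : γ.integral f = γ.integral g := by
  unfold integral
  congr 1
  refine intervalIntegral.integral_congr fun s hs => ?_
  rw [uIcc_of_le zero_le_one] at hs
  simp only [h (γ.path_mem_trace hs)]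

theorem integral_const_mul (c : ℂ) (f : ℂ → ℂ) :
    γ.integral (fun z => c * f z) = c * γ.integral f := by
  simp only [integral, mul_assoc, intervalIntegral.integral_const_mul]
  ring

theorem integral_add {f g : ℂ → ℂ} (hf : ContinuousOn f γ.trace) (hg : ContinuousOn g γ.trace) :
    γ.integral (fun z => f z + g z) = γ.integral f + γ.integral g := by
  simp only [integral, add_mul]
  rw [intervalIntegral.integral_add (γ.intervalIntegrable hf) (γ.intervalIntegrable hg), mul_add]

theorem integral_sub {f g : ℂ → ℂ} (hf : ContinuousOn f γ.trace) (hg : ContinuousOn g γ.trace) :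
    γ.integral (fun z => f z - g z) = γ.integral f - γ.integral g := by
  simp only [integral, sub_mul]
  rw [intervalIntegral.integral_sub (γ.intervalIntegrable hf) (γ.intervalIntegrable hg), mul_sub]

theorem integral_finsetSum {ι : Type*} (S : Finset ι) {f : ι → ℂ → ℂ}
    (hf : ∀ i ∈ S, ContinuousOn (f i) γ.trace) :
    γ.integral (fun z => ∑ i ∈ S, f i z) = ∑ i ∈ S, γ.integral (f i) := by
  simp only [integral, Finset.sum_mul]
  rw [intervalIntegral.integral_finsetSum fun i hi => γ.intervalIntegrable (hf i hi),
    Finset.mul_sum]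

theorem hasSum_integral {ι : Type*} [Countable ι] {F : ι → ℂ → ℂ} {f : ℂ → ℂ} {B : ι → ℝ}
    (hF : ∀ i, ContinuousOn (F i) γ.trace) (hFB : ∀ i, ∀ z ∈ γ.trace, ‖F i z‖ ≤ B i)
    (hB : Summable B) (hf : ∀ z ∈ γ.trace, HasSum (fun i => F i z) (f z)) :
    HasSum (fun i => γ.integral (F i)) (γ.integral f) := by
  refine HasSum.mul_left _ ?_
  have hmem : ∀ s ∈ uIoc (0 : ℝ) 1, γ.path s ∈ γ.trace := fun s hs => by
    rw [uIoc_of_le zero_le_one] at hs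
    exact γ.path_mem_trace (Ioc_subset_Icc_self hs)
  refine intervalIntegral.hasSum_integral_of_dominated_convergence
    (fun i s => B i * ‖deriv γ.path s‖) (fun i => ?_) (fun i => ?_) ?_ ?_ ?_
  · exact (γ.intervalIntegrable (hF i)).aestronglyMeasurable_restrict_uIoc
  · refine ae_of_all _ fun s hs => ?_
    rw [norm_mul]
    exact mul_le_mul_of_nonneg_right (hFB i _ (hmem s hs)) (norm_nonneg _)
  · exact ae_of_all _ fun s _ => hB.mul_right _
  · simp_rw [tsum_mul_right]
    exact γ.integrable_deriv.norm.const_mul _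
  · exact ae_of_all _ fun s hs => (hf _ (hmem s hs)).mul_right _

theorem integral_eq_zero_of_hasDerivAt {F f : ℂ → ℂ} (hF : ∀ z ∈ γ.trace, HasDerivAt F (f z) z)
    (hf : ContinuousOn f γ.trace) : γ.integral f = 0 := by
  obtain ⟨S, hS⟩ := γ.differentiable_off_corners
  have hc : ContinuousOn F γ.trace := fun z hz => (hF z hz).continuousAt.continuousWithinAt
  have := integral_eq_of_hasDerivAt_off_countable_of_le (fun s => F (γ.path s))
    (fun s => f (γ.path s) * deriv γ.path s) zero_le_one S.countable_toSet
    (γ.continuousOn_comp hc) (fun s hs => ?_) (γ.intervalIntegrable hf)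
  · rw [integral, this, γ.closed, sub_self, mul_zero]
  · exact (hF _ (γ.path_mem_trace (Ioo_subset_Icc_self hs.1))).comp s (hS s hs.1 hs.2).hasDerivAt

variable {γ} in
theorem Avoids.continuousOn_sub_zpow {p : ℂ} (h : γ.Avoids p) (m : ℤ) :
    ContinuousOn (fun z => (z - p) ^ m) γ.trace :=
  (continuousOn_id.sub continuousOn_const).zpow₀ m fun _ hz => Or.inl (h.sub_ne_zero hz)

theorem integral_sub_zpow {p : ℂ} (h : γ.Avoids p) {m : ℤ} (hm : m ≠ -1) :
    γ.integral (fun z => (z - p) ^ m) = 0 := by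
  have hm' : (m + 1 : ℂ) ≠ 0 := by
    exact_mod_cast fun h => hm (by omega : m = -1)
  refine γ.integral_eq_zero_of_hasDerivAt (F := fun z => (m + 1 : ℂ)⁻¹ * (z - p) ^ (m + 1))
    (fun z hz => ?_) (h.continuousOn_sub_zpow m)
  have := ((hasDerivAt_zpow (m + 1) (z - p) (Or.inl (h.sub_ne_zero hz))).comp_sub_const z
    p).const_mul (m + 1 : ℂ)⁻¹
  refine this.congr_deriv ?_
  push_cast
  rw [← mul_assoc, inv_mul_cancel₀ hm', one_mul, add_sub_cancel_right]

/-- The image of `γ` under a map `φ` with derivative `φ'`. -/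
def map (φ φ' : ℂ → ℂ) (hφ : ∀ z ∈ γ.trace, HasDerivAt φ (φ' z) z)
    (hφ' : ContinuousOn φ' γ.trace) : Loop where
  path s := φ (γ.path s)
  continuousOn_path :=
    γ.continuousOn_comp fun z hz => (hφ z hz).continuousAt.continuousWithinAt
  closed := by rw [γ.closed]
  differentiable_off_corners := by
    obtain ⟨S, hS⟩ := γ.differentiable_off_corners
    exact ⟨S, fun s hs hs' => ((hφ _ (γ.path_mem_trace (Ioo_subset_Icc_self hs))).comp s
      (hS s hs hs').hasDerivAt).differentiableAt⟩
  integrable_deriv := by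
    refine (γ.intervalIntegrable hφ').congr_ae ?_
    rw [Filter.EventuallyEq, ae_restrict_iff' measurableSet_uIoc]
    filter_upwards [γ.ae_hasDerivAt_path] with s hs hs'
    obtain ⟨hmem, hderiv⟩ := hs hs'
    exact ((hφ _ (γ.path_mem_trace hmem)).comp s hderiv).deriv.symm

theorem integral_map {φ φ' : ℂ → ℂ} (hφ : ∀ z ∈ γ.trace, HasDerivAt φ (φ' z) z)
    (hφ' : ContinuousOn φ' γ.trace) (f : ℂ → ℂ) :
    (γ.map φ φ' hφ hφ').integral f = γ.integral fun z => f (φ z) * φ' z := by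
  unfold integral
  congr 1
  refine intervalIntegral.integral_congr_ae ?_
  filter_upwards [γ.ae_hasDerivAt_path] with s hs hs'
  obtain ⟨hmem, hderiv⟩ := hs hs'
  rw [mul_assoc, ← ((hφ _ (γ.path_mem_trace hmem)).comp s hderiv).deriv]
  rfl

end Loop

/-! ### Laurent expansion on the punctured plane -/

/-- The coefficient of `z ^ m` in the Laurent expansion of `f` about `0`, for `f` holomorphic on
the punctured plane; any circle about `0` could replace the unit circle. -/
def laurentCoeff (f : ℂ → ℂ) (m : ℤ) : ℂ :=
  (2 * Real.pi * Complex.I)⁻¹ * ∮ z in C(0, 1), z ^ (-m - 1) * f z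

theorem differentiableOn_zpow_compl_zero (m : ℤ) :
    DifferentiableOn ℂ (fun z : ℂ => z ^ m) {0}ᶜ :=
  differentiableOn_zpow m _ (Or.inl fun h => h rfl)

section Laurent

open Metric

theorem sphere_subset_compl_zero {R : ℝ} (hR : 0 < R) : sphere (0 : ℂ) R ⊆ {0}ᶜ :=
  fun _ hz => ne_of_mem_sphere hz hR.ne'

theorem circleIntegral_eq_of_differentiableOn_compl_zero {f : ℂ → ℂ}
    (hf : DifferentiableOn ℂ f {0}ᶜ) {r R : ℝ} (hr : 0 < r) (hR : 0 < R) :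
    ∮ z in C(0, R), f z = ∮ z in C(0, r), f z := by
  wlog hrR : r ≤ R generalizing r R
  · exact (this hR hr (le_of_not_ge hrR)).symm
  have hne : closedBall (0 : ℂ) R \ ball 0 r ⊆ {0}ᶜ := fun z hz h0 =>
    hz.2 (by rw [h0]; exact mem_ball_self hr)
  refine Complex.circleIntegral_eq_of_differentiable_on_annulus_off_countable hr hrR
    countable_empty (hf.continuousOn.mono hne) fun z hz => ?_
  have hz0 : z ≠ 0 :=
    hne ⟨ball_subset_closedBall hz.1.1, fun h => hz.1.2 (ball_subset_closedBall h)⟩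
  exact hf.differentiableAt (isOpen_compl_singleton.mem_nhds hz0)

theorem circleIntegral_eq_laurentCoeff {f : ℂ → ℂ} (hf : DifferentiableOn ℂ f {0}ᶜ) {R : ℝ}
    (hR : 0 < R) (m : ℤ) :
    (2 * Real.pi * Complex.I)⁻¹ * ∮ z in C(0, R), z ^ (-m - 1) * f z = laurentCoeff f m := by
  rw [laurentCoeff, circleIntegral_eq_of_differentiableOn_compl_zero
    ((differentiableOn_zpow_compl_zero _).fun_mul hf) one_pos hR]

theorem circleIntegral_cauchy_annulus {f : ℂ → ℂ} (hf : DifferentiableOn ℂ f {0}ᶜ) {u : ℂ}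
    {r R : ℝ} (hr : 0 < r) (hru : r < ‖u‖) (huR : ‖u‖ < R) :
    (∮ z in C(0, R), (z - u)⁻¹ * f z) - ∮ z in C(0, r), (z - u)⁻¹ * f z
      = 2 * Real.pi * Complex.I * f u := by
  have hu0 : u ≠ 0 := norm_pos_iff.1 (hr.trans hru)
  have hR := hr.trans (hru.trans huR)
  have hd : DifferentiableOn ℂ (dslope f u) {0}ᶜ :=
    (Complex.differentiableOn_dslope (isOpen_compl_singleton.mem_nhds hu0)).2 hf
  have split : ∀ ρ > 0, ‖u‖ ≠ ρ → ∮ z in C(0, ρ), dslope f u z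
      = (∮ z in C(0, ρ), (z - u)⁻¹ * f z) - f u * ∮ z in C(0, ρ), (z - u)⁻¹ := by
    intro ρ hρ huρ
    have hne : ∀ z ∈ sphere (0 : ℂ) ρ, z ≠ u := fun z hz h =>
      huρ (by rw [← h, mem_sphere_zero_iff_norm.1 hz])
    have hinv : ContinuousOn (fun z => (z - u)⁻¹) (sphere 0 ρ) :=
      (continuousOn_id.sub continuousOn_const).inv₀ fun z hz => sub_ne_zero.2 (hne z hz)
    rw [← circleIntegral.integral_const_mul, ← circleIntegral.integral_sub
      ((hinv.fun_mul (hf.continuousOn.mono (sphere_subset_compl_zero hρ))).circleIntegrable hρ.le)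
      ((continuousOn_const.fun_mul hinv).circleIntegrable hρ.le)]
    refine circleIntegral.integral_congr hρ.le fun z hz => ?_
    simp only [dslope_of_ne f (hne z hz), slope_def_field]
    ring
  have hin : ∮ z in C(0, R), (z - u)⁻¹ = 2 * Real.pi * Complex.I :=
    circleIntegral.integral_sub_inv_of_mem_ball (mem_ball_zero_iff.2 huR)
  have hout : ∮ z in C(0, r), (z - u)⁻¹ = 0 := by
    have hdiff : DifferentiableOn ℂ (fun z => (z - u)⁻¹) (closedBall 0 r) := fun z hz =>
      ((differentiableAt_id.sub_const u).inv (sub_ne_zero.2 fun h => hru.not_ge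
        (by simpa [← h] using hz))).differentiableWithinAt
    exact Complex.circleIntegral_eq_zero_of_differentiable_on_off_countable hr.le
      countable_empty hdiff.continuousOn fun z hz =>
        hdiff.differentiableAt (closedBall_mem_nhds_of_mem hz.1)
  have h := circleIntegral_eq_of_differentiableOn_compl_zero hd hr hR
  rw [split R hR huR.ne, split r hr hru.ne', hin, hout] at h
  linear_combination h

theorem hasSum_circleIntegral_of_lt_norm {f : ℂ → ℂ} {u : ℂ} {r : ℝ}
    (hf : CircleIntegrable f 0 r) (hr : 0 < r) (hru : r < ‖u‖) :
    HasSum (fun n : ℕ => (∮ z in C(0, r), z ^ n * f z) * u ^ (-((n : ℤ) + 1)))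
      (-∮ z in C(0, r), (z - u)⁻¹ * f z) := by
  have hu : 0 < ‖u‖ := hr.trans hru
  have hq : r / ‖u‖ < 1 := (div_lt_one hu).2 hru
  have hterm : ∀ n : ℕ, (∮ z in C(0, r), z ^ n * f z) * u ^ (-((n : ℤ) + 1))
      = ∮ z in C(0, r), (z / u) ^ n * u⁻¹ * f z := fun n => by
    rw [mul_comm, ← circleIntegral.integral_const_mul]
    congr 1 with z
    rw [zpow_neg, zpow_add_one₀ (norm_pos_iff.1 hu), zpow_natCast]
    ring
  have hsum : -∮ z in C(0, r), (z - u)⁻¹ * f z = ∮ z in C(0, r), (u - z)⁻¹ * f z := by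
    rw [← neg_one_mul, ← circleIntegral.integral_const_mul]
    congr 1 with z
    rw [← neg_sub u z, inv_neg]
    ring
  simp_rw [hterm, hsum, circleIntegral]
  refine intervalIntegral.hasSum_integral_of_dominated_convergence
    (fun n θ => (r / ‖u‖) ^ n * (‖u‖⁻¹ * ‖deriv (circleMap 0 r) θ • f (circleMap 0 r θ)‖))
    (fun n => ?_) (fun n => ?_) ?_ ?_ ?_
  · have hg : Continuous fun θ => (circleMap 0 r θ / u) ^ n * u⁻¹ := by fun_prop
    refine (hf.out.continuousOn_mul hg.continuousOn).def'.1.congr (ae_of_all _ fun θ => ?_)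
    simp only [smul_eq_mul]
    ring
  · refine ae_of_all _ fun θ _ => le_of_eq ?_
    simp only [norm_smul, norm_mul, norm_pow, norm_div, norm_inv, norm_circleMap_zero,
      abs_of_pos hr]
    ring
  · exact ae_of_all _ fun θ _ => (summable_geometric_of_lt_one (by positivity) hq).mul_right _
  · simp_rw [tsum_mul_right]
    exact (hf.out.norm.const_mul _).const_mul _
  · refine ae_of_all _ fun θ _ => HasSum.const_smul _ (HasSum.mul_right _ ?_)
    have hθ : ‖circleMap 0 r θ / u‖ < 1 := by
      rwa [norm_div, norm_circleMap_zero, abs_of_pos hr]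
    convert (hasSum_geometric_of_norm_lt_one hθ).mul_right u⁻¹ using 1
    rw [← mul_inv, sub_mul, one_mul, div_mul_cancel₀ _ (norm_pos_iff.1 hu)]

theorem hasSum_laurentCoeff {f : ℂ → ℂ} (hf : DifferentiableOn ℂ f {0}ᶜ) {u : ℂ} (hu : u ≠ 0) :
    HasSum (fun m : ℤ => laurentCoeff f m * u ^ m) (f u) := by
  have hu' := norm_pos_iff.2 hu
  have hr : 0 < ‖u‖ / 2 := by positivity
  have hR : 0 < 2 * ‖u‖ := by positivity
  have hru : ‖u‖ / 2 < ‖u‖ := half_lt_self hu'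
  have huR : ‖u‖ < 2 * ‖u‖ := by linarith
  have hint : ∀ ρ > 0, CircleIntegrable f 0 ρ := fun ρ hρ =>
    (hf.continuousOn.mono (sphere_subset_compl_zero hρ)).circleIntegrable hρ.le
  have hin := (hasSum_two_pi_I_cauchyPowerSeries_integral (hint _ hR) huR).mul_left
    (2 * Real.pi * Complex.I)⁻¹
  have hout := (hasSum_circleIntegral_of_lt_norm (hint _ hr) hr hru).mul_left
    (2 * Real.pi * Complex.I)⁻¹
  convert HasSum.of_nat_of_neg_add_one (f := fun m : ℤ => laurentCoeff f m * u ^ m)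
    (hin.congr_fun fun n => ?_) (hout.congr_fun fun n => ?_) using 1
  · simp only [zero_add, smul_eq_mul]
    rw [← mul_add, ← sub_eq_add_neg, circleIntegral_cauchy_annulus hf hr hru huR,
      inv_mul_cancel_left₀ Complex.two_pi_I_ne_zero]
  · rw [← circleIntegral_eq_laurentCoeff hf hR, mul_assoc, mul_comm (∮ z in C(0, _), _),
      ← circleIntegral.integral_const_mul]
    congr 2 with z
    rw [sub_zero, ← neg_add', zpow_neg, ← Nat.cast_add_one, zpow_natCast, zpow_natCast, smul_eq_mul,
      smul_eq_mul]
    ring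
  · rw [← circleIntegral_eq_laurentCoeff hf hr, mul_assoc]
    simp only [neg_neg, add_sub_cancel_right, zpow_natCast]

end Laurent

theorem exists_summable_bound_laurentCoeff {f : ℂ → ℂ} (hf : DifferentiableOn ℂ f {0}ᶜ)
    {K : Set ℂ} (hK : IsCompact K) (hK0 : K ⊆ {0}ᶜ) :
    ∃ B : ℤ → ℝ, Summable B ∧ ∀ m, ∀ u ∈ K, ‖laurentCoeff f m * u ^ m‖ ≤ B m := by
  obtain ⟨R, hR, hKR⟩ := hK.isBounded.subset_closedBall_lt 0 0
  obtain ⟨R', hR', hKR'⟩ := (hK.image_of_continuousOn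
    (continuousOn_inv₀.mono hK0)).isBounded.subset_closedBall_lt 0 0
  have hsum : ∀ ρ > 0, Summable fun m : ℤ => ‖laurentCoeff f m‖ * ρ ^ m := fun ρ hρ => by
    have := (hasSum_laurentCoeff hf (Complex.ofReal_ne_zero.2 hρ.ne')).summable.norm
    simpa only [norm_mul, norm_zpow, Complex.norm_real, Real.norm_of_nonneg hρ.le] using this
  refine ⟨_, (hsum R hR).add (hsum R'⁻¹ (inv_pos.2 hR')), fun m u hu => ?_⟩
  have huR : ‖u‖ ≤ R := mem_closedBall_zero_iff.1 (hKR hu)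
  have huR' : ‖u‖⁻¹ ≤ R' := by
    simpa only [norm_inv] using mem_closedBall_zero_iff.1 (hKR' (mem_image_of_mem _ hu))
  rw [norm_mul, norm_zpow, ← mul_add]
  refine mul_le_mul_of_nonneg_left ?_ (norm_nonneg _)
  obtain ⟨n, rfl | rfl⟩ := m.eq_nat_or_neg
  · simp only [zpow_natCast]
    exact (pow_le_pow_left₀ (norm_nonneg _) huR n).trans (le_add_of_nonneg_right (by positivity))
  · simp only [zpow_neg, zpow_natCast, ← inv_pow, inv_inv]
    exact (pow_le_pow_left₀ (by positivity) huR' n).trans (le_add_of_nonneg_left (by positivity))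

theorem Loop.hasSum_laurentCoeff_mul_integral (γ : Loop) {f φ g : ℂ → ℂ}
    (hf : DifferentiableOn ℂ f {0}ᶜ) (hφ : ContinuousOn φ γ.trace)
    (hφ0 : ∀ z ∈ γ.trace, φ z ≠ 0) (hg : ContinuousOn g γ.trace) :
    HasSum (fun m : ℤ => laurentCoeff f m * γ.integral fun z => φ z ^ m * g z)
      (γ.integral fun z => f (φ z) * g z) := by
  obtain ⟨B, hB, hfB⟩ := exists_summable_bound_laurentCoeff hf
    (γ.isCompact_trace.image_of_continuousOn hφ) (image_subset_iff.2 hφ0)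
  obtain ⟨M, hM⟩ := γ.isCompact_trace.exists_bound_of_continuousOn hg
  simp_rw [← γ.integral_const_mul, ← mul_assoc]
  refine γ.hasSum_integral (B := fun m => B m * M) (fun m => ?_) (fun m z hz => ?_)
    (hB.mul_right M) fun z hz => (hasSum_laurentCoeff hf (hφ0 z hz)).mul_right _
  · exact (continuousOn_const.mul (hφ.zpow₀ m fun z hz => Or.inl (hφ0 z hz))).mul hg
  · rw [norm_mul]
    have h := hfB m _ (mem_image_of_mem φ hz)
    exact mul_le_mul h (hM z hz) (norm_nonneg _) ((norm_nonneg _).trans h)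

/-! ### The residue theorem -/

namespace Loop

variable {γ : Loop}

theorem Avoids.continuousOn {γ : Loop} {f : ℂ → ℂ} (h : γ.Avoids 0)
    (hf : DifferentiableOn ℂ f {0}ᶜ) : ContinuousOn f γ.trace :=
  hf.continuousOn.mono h.trace_subset

theorem integral_eq_laurentCoeff_mul_winding (h0 : γ.Avoids 0) {f : ℂ → ℂ}
    (hf : DifferentiableOn ℂ f {0}ᶜ) : γ.integral f = laurentCoeff f (-1) * γ.winding 0 := by
  have h := γ.hasSum_laurentCoeff_mul_integral (φ := id) (g := fun _ => 1) hf continuousOn_id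
    (fun z hz => h0.trace_subset hz) continuousOn_const
  simp only [id, mul_one] at h
  have hterm : ∀ m : ℤ, m ≠ -1 → laurentCoeff f m * γ.integral (fun z => z ^ m) = 0 :=
    fun m hm => by simpa using Or.inr (γ.integral_sub_zpow h0 hm)
  rw [h.unique (hasSum_single _ hterm), winding]
  simp only [sub_zero, zpow_neg_one]

theorem Excludes.integral_eq_zero (h0 : γ.Excludes 0) {f : ℂ → ℂ}
    (hf : DifferentiableOn ℂ f {0}ᶜ) : γ.integral f = 0 := by
  rw [integral_eq_laurentCoeff_mul_winding h0.1 hf, h0.2, mul_zero]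

theorem Includes.integral_zpow_mul (h0 : γ.Includes 0) {f : ℂ → ℂ}
    (hf : DifferentiableOn ℂ f {0}ᶜ) (m : ℤ) :
    γ.integral (fun z => z ^ (-m - 1) * f z) = laurentCoeff f m := by
  have hg := (differentiableOn_zpow_compl_zero (-m - 1)).fun_mul hf
  rw [integral_eq_laurentCoeff_mul_winding h0.1 hg, h0.2, mul_one, laurentCoeff, laurentCoeff]
  simp only [neg_neg, sub_self, zpow_zero, one_mul]

end Loop

theorem differentiableOn_iterate_dslope {f : ℂ → ℂ} (hf : DifferentiableOn ℂ f {0}ᶜ) {p : ℂ}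
    (hp : p ≠ 0) (n : ℕ) : DifferentiableOn ℂ ((Function.swap dslope p)^[n] f) {0}ᶜ := by
  induction n with
  | zero => exact hf
  | succ n ih =>
    rw [Function.iterate_succ_apply']
    exact (Complex.differentiableOn_dslope (isOpen_compl_singleton.mem_nhds hp)).2 ih

theorem eq_sum_iterate_dslope_add {𝕜 : Type*} [NontriviallyNormedField 𝕜] (f : 𝕜 → 𝕜) (p z : 𝕜)
    (n : ℕ) :
    f z = ∑ j ∈ Finset.range n, (Function.swap dslope p)^[j] f p * (z - p) ^ j
      + (z - p) ^ n * (Function.swap dslope p)^[n] f z := by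
  induction n with
  | zero => simp only [Finset.range_zero, Finset.sum_empty, pow_zero, one_mul, zero_add,
      Function.iterate_zero_apply]
  | succ n ih =>
    have h := sub_smul_dslope ((Function.swap dslope p)^[n] f) p z
    rw [smul_eq_mul] at h
    rw [Finset.sum_range_succ, Function.iterate_succ_apply', Function.swap]
    linear_combination ih - (z - p) ^ n * h

namespace Loop

theorem integral_mul_sub_zpow_eq_sum_add {γ : Loop} {p : ℂ} (h0 : γ.Avoids 0) (hp : γ.Avoids p)
    (hp0 : p ≠ 0) {f g : ℂ → ℂ} (hf : DifferentiableOn ℂ f {0}ᶜ) (hg : ContinuousOn g γ.trace)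
    (m : ℤ) (n : ℕ) :
    γ.integral (fun z => g z * f z * (z - p) ^ m)
      = ∑ j ∈ Finset.range n,
          (Function.swap dslope p)^[j] f p * γ.integral (fun z => g z * (z - p) ^ (m + j))
        + γ.integral fun z => g z * (Function.swap dslope p)^[n] f z * (z - p) ^ (m + n) := by
  have hterm : ∀ j ∈ Finset.range n, ContinuousOn
      (fun z => (Function.swap dslope p)^[j] f p * (g z * (z - p) ^ (m + j))) γ.trace :=
    fun j _ => continuousOn_const.mul (hg.mul (hp.continuousOn_sub_zpow _))
  have hrem : ContinuousOn
      (fun z => g z * (Function.swap dslope p)^[n] f z * (z - p) ^ (m + n)) γ.trace :=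
    (hg.mul (h0.continuousOn (differentiableOn_iterate_dslope hf hp0 n))).mul
      (hp.continuousOn_sub_zpow _)
  simp_rw [← γ.integral_const_mul]
  rw [← γ.integral_finsetSum _ hterm, ← γ.integral_add (continuousOn_finsetSum _ hterm) hrem]
  refine γ.integral_congr fun z hz => ?_
  simp only [zpow_add₀ (hp.sub_ne_zero hz), zpow_natCast]
  nth_rw 1 [eq_sum_iterate_dslope_add f p z n]
  rw [mul_add, add_mul, Finset.mul_sum, Finset.sum_mul]
  refine congr_arg₂ _ (Finset.sum_congr rfl fun j _ => ?_) ?_ <;> ring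

theorem integral_mul_sub_zpow_neg {γ : Loop} {p : ℂ} (h0 : γ.Avoids 0) (hp : γ.Avoids p)
    (hp0 : p ≠ 0) {f : ℂ → ℂ} (hf : DifferentiableOn ℂ f {0}ᶜ) (n : ℕ) :
    γ.integral (fun z => f z * (z - p) ^ (-(n : ℤ) - 1))
      = (Function.swap dslope p)^[n] f p * γ.winding p
        + γ.integral ((Function.swap dslope p)^[n + 1] f) := by
  have h := integral_mul_sub_zpow_eq_sum_add h0 hp hp0 hf (g := fun _ => 1) continuousOn_const
    (-(n : ℤ) - 1) (n + 1)
  simp only [one_mul] at h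
  have hlast : -(n : ℤ) - 1 + n = -1 := by ring
  have hrem : -(n : ℤ) - 1 + (n + 1 : ℕ) = 0 := by push_cast; ring
  have hlow : ∀ j ∈ Finset.range n,
      (Function.swap dslope p)^[j] f p * γ.integral (fun z => (z - p) ^ (-(n : ℤ) - 1 + j)) = 0 :=
    fun j hj => by
      rw [γ.integral_sub_zpow hp (by have := Finset.mem_range.1 hj; omega), mul_zero]
  rw [h, Finset.sum_range_succ, Finset.sum_eq_zero hlow, zero_add, hlast, hrem]
  simp only [zpow_neg_one, zpow_zero, mul_one, winding]

theorem exists_integral_mul_sub_zpow_eq {p : ℂ} (hp0 : p ≠ 0) {f : ℂ → ℂ}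
    (hf : DifferentiableOn ℂ f {0}ᶜ) (m : ℤ) :
    ∃ A B : ℂ, ∀ γ : Loop, γ.Avoids 0 → γ.Avoids p →
      γ.integral (fun z => f z * (z - p) ^ m) = A * γ.winding 0 + B * γ.winding p := by
  obtain hm | ⟨n, rfl⟩ : 0 ≤ m ∨ ∃ n : ℕ, m = -(n : ℤ) - 1 := by
    rcases m with n | n
    · exact Or.inl (Int.natCast_nonneg n)
    · exact Or.inr ⟨n, by rw [Int.negSucc_eq]; ring⟩
  · lift m to ℕ using hm
    have hfm : DifferentiableOn ℂ (fun z => f z * (z - p) ^ (m : ℤ)) {0}ᶜ := by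
      simp only [zpow_natCast]
      exact hf.mul ((differentiableOn_id.sub_const p).pow m)
    exact ⟨laurentCoeff (fun z => f z * (z - p) ^ (m : ℤ)) (-1), 0, fun γ h0 _ => by
      rw [integral_eq_laurentCoeff_mul_winding h0 hfm, zero_mul, add_zero]⟩
  · refine ⟨laurentCoeff ((Function.swap dslope p)^[n + 1] f) (-1),
      (Function.swap dslope p)^[n] f p, fun γ h0 hp => ?_⟩
    rw [integral_mul_sub_zpow_neg h0 hp hp0 hf, add_comm,
      integral_eq_laurentCoeff_mul_winding h0 (differentiableOn_iterate_dslope hf hp0 _)]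

theorem integral_mul_sub_zpow_eq_of_includes {γ γ' : Loop} {p : ℂ} (h0 : γ.Includes 0)
    (hp : γ.Excludes p) (h0' : γ'.Includes 0) (hp' : γ'.Excludes p) (hp0 : p ≠ 0) {f : ℂ → ℂ}
    (hf : DifferentiableOn ℂ f {0}ᶜ) (m : ℤ) :
    γ.integral (fun z => f z * (z - p) ^ m) = γ'.integral fun z => f z * (z - p) ^ m := by
  obtain ⟨A, B, h⟩ := exists_integral_mul_sub_zpow_eq hp0 hf m
  rw [h γ h0.1 hp.1, h γ' h0'.1 hp'.1, h0.2, hp.2, h0'.2, hp'.2]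

theorem sum_integral_mul_integral {γ : Loop} {p : ℂ} (h0 : γ.Excludes 0) (hp : γ.Includes p)
    (hp0 : p ≠ 0) {f g : ℂ → ℂ} (hf : DifferentiableOn ℂ f {0}ᶜ)
    (hg : DifferentiableOn ℂ g {0}ᶜ) (m n : ℕ) :
    ∑ k ∈ Finset.range n, γ.integral (fun z => f z * (z - p) ^ ((m : ℤ) - k - 1))
        * γ.integral (fun z => g z * (z - p) ^ ((k : ℤ) - n))
      = γ.integral fun z => f z * g z * (z - p) ^ ((m : ℤ) - n) := by
  have hrem : γ.integral (fun z => f z * (Function.swap dslope p)^[n] g z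
      * (z - p) ^ ((m : ℤ) - n + n)) = 0 := by
    simp only [sub_add_cancel, zpow_natCast]
    exact h0.integral_eq_zero ((hf.fun_mul (differentiableOn_iterate_dslope hg hp0 n)).fun_mul
      ((differentiableOn_id.sub_const p).pow m))
  rw [integral_mul_sub_zpow_eq_sum_add h0.1 hp.1 hp0 hg (h0.1.continuousOn hf), hrem, add_zero,
    ← Finset.sum_range_reflect]
  refine Finset.sum_congr rfl fun j hj => ?_
  have hj := Finset.mem_range.1 hj
  have ef : (m : ℤ) - (n - 1 - j : ℕ) - 1 = m - n + j := by omega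
  have eg : ((n - 1 - j : ℕ) : ℤ) - n = -(j : ℤ) - 1 := by omega
  rw [ef, eg, integral_mul_sub_zpow_neg h0.1 hp.1 hp0 hg, hp.2,
    h0.integral_eq_zero (differentiableOn_iterate_dslope hg hp0 _), mul_one, add_zero, mul_comm]

end Loop

theorem zpow_neg_mul_inv_sub_eq_sum_add {K : Type*} [Field K] {x y : K} (hx : x ≠ 0) (hy : y ≠ 0)
    (hxy : x ≠ y) (n : ℕ) :
    y ^ (-(n : ℤ)) * (x - y)⁻¹
      = ∑ k ∈ Finset.range n, x ^ (-(k : ℤ) - 1) * y ^ ((k : ℤ) - n)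
        + x ^ (-(n : ℤ)) * (x - y)⁻¹ := by
  have hsub : x - y ≠ 0 := sub_ne_zero.2 hxy
  have hgeom := geom_sum₂_mul x⁻¹ y⁻¹ n
  have hterm : ∀ k ∈ Finset.range n, x ^ (-(k : ℤ) - 1) * y ^ ((k : ℤ) - n)
      = x⁻¹ ^ k * y⁻¹ ^ (n - 1 - k) * (x⁻¹ * y⁻¹) := fun k hk => by
    have hk := Finset.mem_range.1 hk
    have e : (k : ℤ) - n = -((n - 1 - k : ℕ) : ℤ) - 1 := by omega
    rw [e, zpow_sub_one₀ hx, zpow_sub_one₀ hy, zpow_neg, zpow_neg, zpow_natCast, zpow_natCast,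
      inv_pow, inv_pow]
    ring
  have hinv : x⁻¹ * y⁻¹ * (x - y) = -(x⁻¹ - y⁻¹) := by
    field_simp
    ring
  rw [Finset.sum_congr rfl hterm, ← Finset.sum_mul, ← sub_eq_iff_eq_add, ← sub_mul,
    mul_inv_eq_iff_eq_mul₀ hsub, mul_assoc, hinv, mul_neg, hgeom, zpow_neg, zpow_neg, zpow_natCast,
    zpow_natCast, inv_pow, inv_pow, neg_sub]

theorem Loop.integral_mul_sub_zpow_mul_inv_sub {γ : Loop} {p w : ℂ} (h0 : γ.Excludes 0)
    (hp : γ.Avoids p) (hw : γ.Excludes w) (hw0 : w ≠ 0) (hwp : w ≠ p) {f : ℂ → ℂ}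
    (hf : DifferentiableOn ℂ f {0}ᶜ) (n : ℕ) :
    γ.integral (fun z => f z * (z - p) ^ (-(n : ℤ)) * (w - z)⁻¹)
      = ∑ k ∈ Finset.range n,
          (w - p) ^ (-(k : ℤ) - 1) * γ.integral fun z => f z * (z - p) ^ ((k : ℤ) - n) := by
  have hcauchy : γ.integral (fun z => f z * (z - w) ^ (-1 : ℤ)) = 0 := by
    have h := integral_mul_sub_zpow_neg h0.1 hw.1 hw0 hf 0
    rwa [hw.2, h0.integral_eq_zero (differentiableOn_iterate_dslope hf hw0 _), mul_zero,
      add_zero] at h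
  have hcont : ∀ {q : ℂ}, γ.Avoids q → ∀ (c : ℂ) (m : ℤ),
      ContinuousOn (fun z => c * (f z * (z - q) ^ m)) γ.trace := fun hq c m =>
    continuousOn_const.mul ((h0.1.continuousOn hf).mul (hq.continuousOn_sub_zpow m))
  have hsplit : ∀ z ∈ γ.trace, f z * (z - p) ^ (-(n : ℤ)) * (w - z)⁻¹
      = ∑ k ∈ Finset.range n, (w - p) ^ (-(k : ℤ) - 1) * (f z * (z - p) ^ ((k : ℤ) - n))
        + -(w - p) ^ (-(n : ℤ)) * (f z * (z - w) ^ (-1 : ℤ)) := fun z hz => by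
    have hzw : w - p ≠ z - p := fun h => hw.1.sub_ne_zero hz (by linear_combination -h)
    have h := zpow_neg_mul_inv_sub_eq_sum_add (sub_ne_zero.2 hwp) (hp.sub_ne_zero hz) hzw n
    rw [sub_sub_sub_cancel_right] at h
    rw [mul_assoc, h, mul_add, Finset.mul_sum, zpow_neg_one, ← neg_sub w z, inv_neg]
    refine congr_arg₂ _ (Finset.sum_congr rfl fun k _ => ?_) ?_ <;> ring
  rw [γ.integral_congr hsplit, γ.integral_add
    (continuousOn_finsetSum _ fun k _ => hcont hp _ _) (hcont hw.1 _ _),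
    γ.integral_finsetSum _ fun k _ => hcont hp _ _]
  simp only [integral_const_mul, hcauchy, mul_zero, add_zero]

namespace Loop

variable {γ : Loop} {p : ℂ} {f : ℂ → ℂ}

theorem mul_integral_mul_sub_zpow_sub_one (h0 : γ.Avoids 0) (hp : γ.Avoids p)
    (hf : DifferentiableOn ℂ f {0}ᶜ) (m : ℤ) :
    m * γ.integral (fun z => f z * (z - p) ^ (m - 1))
      = -γ.integral fun z => deriv f z * (z - p) ^ m := by
  have hf' := hf.deriv isOpen_compl_singleton
  have hd : ContinuousOn (fun z => deriv f z * (z - p) ^ m) γ.trace :=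
    (h0.continuousOn hf').mul (hp.continuousOn_sub_zpow m)
  have hz : ContinuousOn (fun z => m * (f z * (z - p) ^ (m - 1))) γ.trace :=
    continuousOn_const.mul ((h0.continuousOn hf).mul (hp.continuousOn_sub_zpow _))
  rw [← γ.integral_const_mul, eq_neg_iff_add_eq_zero, ← γ.integral_add hz hd]
  refine γ.integral_eq_zero_of_hasDerivAt (F := fun z => f z * (z - p) ^ m) (fun z hz => ?_)
    (hz.add hd)
  have hfz := (hf.differentiableAt (isOpen_compl_singleton.mem_nhds
    (h0.trace_subset hz))).hasDerivAt
  have hpz := (hasDerivAt_zpow m (z - p) (Or.inl (hp.sub_ne_zero hz))).comp_sub_const z p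
  exact (hfz.mul hpz).congr_deriv (by ring)

theorem mul_integral_zpow_mul_mul_sub_zpow (h0 : γ.Avoids 0) (hp : γ.Avoids p)
    (hf : DifferentiableOn ℂ f {0}ᶜ) (d : ℕ) (x : ℤ) :
    d * γ.integral (fun z => z ^ x * f z * (z - p) ^ (-((d + 1 : ℕ) : ℤ)))
      = x * γ.integral (fun z => z ^ x * (z⁻¹ * f z) * (z - p) ^ (-(d : ℤ)))
        + γ.integral fun z => z ^ x * deriv f z * (z - p) ^ (-(d : ℤ)) := by
  have hx := differentiableOn_zpow_compl_zero x
  have hinv : DifferentiableOn ℂ (fun z : ℂ => z⁻¹) {0}ᶜ := differentiableOn_inv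
  have hpd := hp.continuousOn_sub_zpow (-(d : ℤ))
  have h := mul_integral_mul_sub_zpow_sub_one h0 hp (hx.fun_mul hf) (-(d : ℤ))
  rw [Int.cast_neg, Int.cast_natCast, neg_mul, neg_inj, ← neg_add', ← Nat.cast_add_one] at h
  rw [h, ← γ.integral_const_mul, ← γ.integral_add
    (continuousOn_const.fun_mul ((h0.continuousOn (hx.fun_mul (hinv.fun_mul hf))).fun_mul hpd))
    ((h0.continuousOn (hx.fun_mul (hf.deriv isOpen_compl_singleton))).fun_mul hpd)]
  refine γ.integral_congr fun z hz => ?_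
  have hz0 : z ≠ 0 := h0.trace_subset hz
  have hfz := hf.differentiableAt (isOpen_compl_singleton.mem_nhds hz0)
  simp only [deriv_fun_mul (differentiableAt_zpow.2 (Or.inl hz0)) hfz, deriv_zpow,
    zpow_sub_one₀ hz0]
  ring

open Polynomial in
theorem exists_polynomial_integral_zpow_mul (h0 : γ.Excludes 0) (hp : γ.Avoids p) (hp0 : p ≠ 0)
    (hf : DifferentiableOn ℂ f {0}ᶜ) (d : ℕ) :
    ∃ P : ℂ[X], P.degree < d ∧ ∀ x : ℤ,
      γ.integral (fun z => z ^ x * f z * (z - p) ^ (-(d : ℤ))) = p ^ x * P.eval (x : ℂ) := by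
  induction d generalizing f with
  | zero =>
    refine ⟨0, WithBot.bot_lt_coe _, fun x => ?_⟩
    simpa using h0.integral_eq_zero ((differentiableOn_zpow_compl_zero x).fun_mul hf)
  | succ d ih =>
    rcases eq_or_ne d 0 with rfl | hd
    · refine ⟨C (f p * γ.winding p), degree_C_le.trans_lt (by norm_num), fun x => ?_⟩
      have hx := (differentiableOn_zpow_compl_zero x).fun_mul hf
      have h := integral_mul_sub_zpow_neg h0.1 hp hp0 hx 0
      rw [h0.integral_eq_zero (differentiableOn_iterate_dslope hx hp0 _), add_zero] at h
      rw [eval_C, ← mul_assoc]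
      exact h
    · obtain ⟨P, hP, hPx⟩ := ih (differentiableOn_inv.fun_mul hf)
      obtain ⟨Q, hQ, hQx⟩ := ih (hf.deriv isOpen_compl_singleton)
      have hd' : (d : ℂ) ≠ 0 := Nat.cast_ne_zero.2 hd
      refine ⟨C (d : ℂ)⁻¹ * (X * P + Q), ?_, fun x => ?_⟩
      · rw [degree_C_mul (inv_ne_zero hd'), Nat.cast_add_one]
        refine (degree_add_le _ _).trans_lt
          (max_lt ?_ (hQ.trans (by exact_mod_cast d.lt_succ_self)))
        rw [mul_comm, degree_mul_X]
        exact WithBot.add_lt_add_right WithBot.one_ne_bot hP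
      · rw [← mul_right_inj' hd', mul_integral_zpow_mul_mul_sub_zpow h0.1 hp hf, hPx, hQx]
        simp only [eval_mul, eval_C, eval_add, eval_X]
        field_simp

end Loop

/-! ### Dual families -/

section Biorthonormal

variable {ι α : Type*} [DecidableEq ι] {ψ Φ : ι → α → ℂ}

theorem hasSum_mul_sum_smul
    (h : ∀ l k, HasSum (fun x => ψ l x * Φ k x) (if k = l then 1 else 0)) (s : Finset ι)
    (c : ι → ℂ) (l : ι) :
    HasSum (fun x => ψ l x * (∑ k ∈ s, c k • Φ k) x) (if l ∈ s then c l else 0) := by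
  have hsum := hasSum_sum (s := s) fun k _ => (h l k).mul_left (c k)
  simp only [mul_ite, mul_one, mul_zero, Finset.sum_ite_eq'] at hsum
  refine hsum.congr_fun fun x => ?_
  rw [Finset.sum_apply, Finset.mul_sum]
  refine Finset.sum_congr rfl fun k _ => ?_
  rw [Pi.smul_apply, smul_eq_mul]
  ring

theorem linearIndependent_of_biorthonormal
    (h : ∀ l k, HasSum (fun x => ψ l x * Φ k x) (if k = l then 1 else 0)) :
    LinearIndependent ℂ Φ := by
  refine linearIndependent_iff'.2 fun s c hc l hl => ?_
  have hsum := hasSum_mul_sum_smul h s c l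
  simp only [hc, Pi.zero_apply, mul_zero, if_pos hl] at hsum
  exact hsum.unique hasSum_zero

end Biorthonormal

theorem IsDualFamily.unique {C : Loop} {a b : ℝ → ℝ} {v : ℕ → ℝ} {y : ℕ → ℤ} {n : ℕ} {t : ℝ}
    {Φ Φ' : Fin n → ℤ → ℂ} (h : IsDualFamily C a b v y n t Φ)
    (h' : IsDualFamily C a b v y n t Φ') : Φ' = Φ := by
  funext k
  have hmem : Φ' k ∈ Submodule.span ℂ (range Φ) := by
    rw [h.2, ← h'.2]
    exact Submodule.subset_span (mem_range_self k)
  obtain ⟨c, hc⟩ := (Submodule.mem_span_range_iff_exists_fun ℂ).1 hmem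
  have hcoeff : ∀ l, c l = if k = l then 1 else 0 := fun l => by
    have hsum := hasSum_mul_sum_smul h.1 Finset.univ c l
    rw [hc, if_pos (Finset.mem_univ l)] at hsum
    exact hsum.unique (h'.1 l k)
  simp_rw [← hc, hcoeff, ite_smul, one_smul, zero_smul]
  exact (Finset.sum_ite_eq Finset.univ k Φ).trans (if_pos (Finset.mem_univ k))

open Polynomial in
theorem V_one_eq_map_degreeLT (n : ℕ) :
    V (fun _ => 1) n
      = (degreeLT ℂ n).map (LinearMap.pi fun x : ℤ => leval (x : ℂ)) := by
  rw [degreeLT_eq_span_X_pow, Submodule.map_span, V]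
  congr 1
  ext f
  have hpow : ∀ l : ℕ, LinearMap.pi (fun x : ℤ => leval (x : ℂ)) (X ^ l : ℂ[X])
      = fun x : ℤ => (x : ℂ) ^ l := fun l => by
    ext x
    simp only [LinearMap.pi_apply, leval_apply, eval_pow, eval_X]
  simp only [Finset.coe_image, Finset.coe_range, image_image, hpow, Finset.filter_true,
    Nat.card_Icc, add_tsub_cancel_right, Complex.ofReal_one, one_zpow, mul_one, mem_ofPred_eq,
    mem_image, mem_Iio]
  constructor
  · rintro ⟨_, _, l, hl, rfl⟩
    exact ⟨l, hl, rfl⟩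
  · rintro ⟨l, hl, rfl⟩
    exact ⟨1, Finset.mem_Icc.2 ⟨le_rfl, by omega⟩, l, hl, rfl⟩

open Polynomial in
theorem span_range_eq_V_one {n : ℕ} {Φ : Fin n → ℤ → ℂ} (hli : LinearIndependent ℂ Φ)
    (hΦ : ∀ k, ∃ P : ℂ[X], P.degree < n ∧ ∀ x : ℤ, Φ k x = P.eval (x : ℂ)) :
    Submodule.span ℂ (range Φ) = V (fun _ => 1) n := by
  have : FiniteDimensional ℂ (degreeLT ℂ n) := (degreeLTEquiv ℂ n).symm.finiteDimensional
  rw [V_one_eq_map_degreeLT]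
  refine Submodule.eq_of_le_of_finrank_le (Submodule.span_le.2 ?_) ?_
  · rintro _ ⟨k, rfl⟩
    obtain ⟨P, hP, hPx⟩ := hΦ k
    exact ⟨P, mem_degreeLT.2 hP, funext fun x => (hPx x).symm⟩
  · calc _ ≤ Module.finrank ℂ (degreeLT ℂ n) := Submodule.finrank_map_le _ _
      _ = n := by rw [(degreeLTEquiv ℂ n).finrank_eq, Module.finrank_fin_fun]
      _ = _ := by rw [finrank_span_eq_card hli, Fintype.card_fin]

/-! ### Inversion -/

/-- The image of `γ` under `z ↦ 1 / z`. -/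
def Loop.inv (γ : Loop) (h0 : γ.Avoids 0) : Loop :=
  γ.map (fun z => z⁻¹) (fun z => -(z ^ 2)⁻¹) (fun _ hz => hasDerivAt_inv (h0.trace_subset hz))
    (((continuousOn_pow 2).inv₀ fun _ hz => pow_ne_zero 2 (h0.trace_subset hz)).neg)

namespace Loop

variable {γ : Loop}

theorem integral_eq_neg_integral_inv (h0 : γ.Avoids 0) (f : ℂ → ℂ) :
    γ.integral f = -(γ.inv h0).integral fun w => w ^ (-2 : ℤ) * f w⁻¹ := by
  rw [inv, integral_map, ← neg_one_mul, ← γ.integral_const_mul]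
  refine γ.integral_congr fun z hz => ?_
  have hz0 : z ≠ 0 := h0.trace_subset hz
  simp only [inv_inv, inv_zpow', neg_neg]
  rw [zpow_ofNat]
  field_simp

theorem winding_inv (h0 : γ.Avoids 0) {q : ℂ} (hq : γ.Avoids q⁻¹) (hq0 : q ≠ 0) :
    (γ.inv h0).winding q = γ.winding q⁻¹ - γ.winding 0 := by
  have hcont : ∀ {p : ℂ}, γ.Avoids p → ContinuousOn (fun z => (z - p)⁻¹) γ.trace := fun hp => by
    simpa only [zpow_neg_one] using hp.continuousOn_sub_zpow (-1)
  rw [winding, winding, winding, inv, integral_map, ← γ.integral_sub (hcont hq) (hcont h0)]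
  refine γ.integral_congr fun z hz => ?_
  have hz0 : z ≠ 0 := h0.trace_subset hz
  have hzq : z * q - 1 ≠ 0 := fun h => hq.trace_subset hz (eq_inv_of_mul_eq_one_left
    (by linear_combination h))
  have e1 : z⁻¹ - q = -(z * q - 1) / z := by field_simp; ring
  have e2 : z - q⁻¹ = (z * q - 1) / q := by field_simp
  simp only [e1, e2, sub_zero]
  field_simp
  ring

theorem winding_inv_zero (h0 : γ.Avoids 0) : (γ.inv h0).winding 0 = -γ.winding 0 := by
  rw [winding, winding, γ.integral_eq_neg_integral_inv h0, neg_neg]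
  refine integral_congr _ fun w _ => ?_
  rw [sub_zero, sub_zero, inv_inv, ← zpow_neg_one]
  by_cases hw0 : w = 0
  · simp [hw0]
  · rw [← zpow_add_one₀ hw0]
    rfl

theorem integral_mul_one_sub_zpow_eq_add {C γ₀ γ₁ : Loop} (hC0 : C.Includes 0)
    (hC1 : C.Excludes 1) (h₀ : γ₀.Includes 0) (h₀₁ : γ₀.Excludes 1) (h₁ : γ₁.Includes 1)
    (h₁₀ : γ₁.Excludes 0) {f g : ℂ → ℂ} (m : ℤ) (hg : DifferentiableOn ℂ g {0}ᶜ)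
    (hfg : ∀ w ≠ 0, w ^ (-m - 2) * f w⁻¹ = g w) :
    C.integral (fun z => f z * (1 - z) ^ m)
      = γ₀.integral (fun w => g w * (w - 1) ^ m) + γ₁.integral fun w => g w * (w - 1) ^ m := by
  have hi0 : (C.inv hC0.1).Avoids 0 := fun s hs => inv_ne_zero (hC0.1 s hs)
  have hi1 : (C.inv hC0.1).Avoids 1 := fun s hs h => hC1.1 s hs (inv_eq_one.1 h)
  have hw1 : (C.inv hC0.1).winding 1 = -1 := by
    rw [winding_inv hC0.1 (by simpa using hC1.1) one_ne_zero, inv_one, hC1.2, hC0.2, zero_sub]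
  have hsubst : C.integral (fun z => f z * (1 - z) ^ m)
      = -(C.inv hC0.1).integral fun w => g w * (w - 1) ^ m := by
    rw [integral_eq_neg_integral_inv hC0.1]
    refine congr_arg Neg.neg (integral_congr _ fun w hw => ?_)
    have hw0 : w ≠ 0 := hi0.trace_subset hw
    have e : 1 - w⁻¹ = w⁻¹ * (w - 1) := by field_simp
    simp only [← hfg w hw0, e, mul_zpow, inv_zpow', zpow_sub₀ hw0, zpow_neg]
    ring
  obtain ⟨A, B, hAB⟩ := exists_integral_mul_sub_zpow_eq one_ne_zero hg m
  rw [hsubst, hAB _ hi0 hi1, hAB _ h₀.1 h₀₁.1, hAB _ h₁₀.1 h₁.1, winding_inv_zero, hw1, hC0.2,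
    h₀.2, h₀₁.2, h₁.2, h₁₀.2]
  ring

end Loop

/-- The factor `z ^ m * exp (α z + β / z)` of the integrands: all of them are such functions times
powers of `z - 1`. -/
def expMonomial (m : ℤ) (α β : ℂ) (z : ℂ) : ℂ := z ^ m * Complex.exp (α * z + β / z)

theorem differentiableOn_expMonomial (m : ℤ) (α β : ℂ) :
    DifferentiableOn ℂ (expMonomial m α β) {0}ᶜ :=
  (differentiableOn_zpow_compl_zero m).mul (((differentiableOn_id.const_mul α).add
    ((differentiableOn_const β).div differentiableOn_id fun _ hz => hz)).cexp)

theorem expMonomial_mul {z : ℂ} (hz : z ≠ 0) (m m' : ℤ) (α β α' β' : ℂ) :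
    expMonomial m α β z * expMonomial m' α' β' z = expMonomial (m + m') (α + α') (β + β') z := by
  rw [expMonomial, expMonomial, expMonomial, zpow_add₀ hz, mul_mul_mul_comm, ← Complex.exp_add]
  congr 2
  ring

theorem expMonomial_inv (m : ℤ) (α β z : ℂ) :
    expMonomial m α β z⁻¹ = expMonomial (-m) β α z := by
  rw [expMonomial, expMonomial, inv_zpow', div_inv_eq_mul, ← div_eq_mul_inv, add_comm]

theorem zpow_mul_expMonomial {z : ℂ} (hz : z ≠ 0) (j m : ℤ) (α β : ℂ) :
    z ^ j * expMonomial m α β z = expMonomial (j + m) α β z := by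
  rw [expMonomial, expMonomial, zpow_add₀ hz, mul_assoc]

/-! ### The dual family for unit rates and step initial condition -/

theorem Psi_one_step {C : Loop} (hC1 : C.Avoids 1) (a b : ℝ → ℝ) (n : ℕ) (t : ℝ) (l : ℕ) (x : ℤ) :
    Psi C a b (fun _ => 1) (fun k => -(k : ℤ)) n t (l + 1) x
      = C.integral fun z => expMonomial (x + l) (b t) (a t) z * (1 - z) ^ ((n : ℤ) - l - 1) := by
  refine C.integral_congr fun z hz => ?_
  have hz1 : 1 - z ≠ 0 := sub_ne_zero.2 fun h => hC1.trace_subset hz h.symm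
  have hm : (n : ℤ) - l - 1 = n - (l + 1 : ℕ) := by push_cast; ring
  have hx : x - -((l + 1 : ℕ) : ℤ) - 1 = x + l := by push_cast; ring
  simp only [Complex.ofReal_one, one_mul, Finset.prod_const, Nat.card_Icc, Nat.add_sub_cancel]
  rw [expMonomial, hm, hx, zpow_sub₀ hz1, zpow_natCast, zpow_natCast, add_comm (_ / z)]

/-- The dual functions `Φ^{n,t}_{n-k}` for unit rates and step initial condition, as integrals
along a loop around `1`; as in `IsDualFamily`, the index `k : Fin n` stands for `k + 1`. -/
def stepDual (γ : Loop) (a b : ℝ → ℝ) (n : ℕ) (t : ℝ) (k : Fin n) (x : ℤ) : ℂ :=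
  γ.integral fun z => expMonomial (x + n) (-a t) (-b t) z * (z - 1) ^ ((k : ℤ) - n)

theorem exists_polynomial_stepDual {γ : Loop} (h0 : γ.Excludes 0) (h1 : γ.Avoids 1)
    (a b : ℝ → ℝ) (n : ℕ) (t : ℝ) (k : Fin n) :
    ∃ P : Polynomial ℂ, P.degree < n ∧ ∀ x : ℤ, stepDual γ a b n t k x = P.eval (x : ℂ) := by
  obtain ⟨P, hP, hPx⟩ := Loop.exists_polynomial_integral_zpow_mul h0 h1 one_ne_zero
    (differentiableOn_expMonomial n (-a t) (-b t)) (n - k)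
  refine ⟨P, hP.trans_le (by exact_mod_cast Nat.sub_le n k), fun x => ?_⟩
  have hexp : -((n - k : ℕ) : ℤ) = (k : ℤ) - n := by omega
  rw [← one_mul (P.eval _), ← one_zpow x, ← hPx, hexp]
  refine γ.integral_congr fun z hz => ?_
  rw [zpow_mul_expMonomial (h0.1.trace_subset hz)]

theorem integral_stepDual_pairing {γ : Loop} (h1 : γ.Includes 1) (h0 : γ.Avoids 0) (α β : ℂ)
    {n d : ℕ} (l k : Fin n) (hd : (n : ℤ) - l - 1 = d) :
    γ.integral (fun z => expMonomial (l + 1) β α z⁻¹ * (1 - z⁻¹) ^ d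
      * (expMonomial n (-α) (-β) z * (z - 1) ^ ((k : ℤ) - n))) = if k = l then 1 else 0 := by
  trans γ.integral fun z => (z - 1) ^ ((k : ℤ) - l - 1)
  · refine γ.integral_congr fun z hz => ?_
    have hz0 : z ≠ 0 := h0.trace_subset hz
    have hz1 : 1 - z⁻¹ = (z - 1) * z⁻¹ := by field_simp
    have hn : (k : ℤ) - l - 1 = d + (k - n) := by omega
    have hexp : expMonomial (-(l + 1)) α β z * expMonomial n (-α) (-β) z = z ^ d := by
      rw [expMonomial_mul hz0, add_neg_cancel, add_neg_cancel, expMonomial, zero_mul, zero_div,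
        add_zero, Complex.exp_zero, mul_one, ← zpow_natCast, ← hd]
      congr 1
      ring
    rw [expMonomial_inv, hz1, mul_pow, inv_pow, hn, zpow_add₀ (h1.1.sub_ne_zero hz),
      zpow_natCast, mul_mul_mul_comm, hexp]
    field_simp
  · split_ifs with hkl
    · simp only [hkl, sub_self, zero_sub, zpow_neg_one]
      exact h1.2
    · exact γ.integral_sub_zpow h1.1 fun h => hkl (Fin.ext (by omega))

theorem hasSum_Psi_mul_stepDual {C γ : Loop} (hC0 : C.Includes 0) (hC1 : C.Excludes 1)
    (h1 : γ.Includes 1) (h0 : γ.Avoids 0) (a b : ℝ → ℝ) (n : ℕ) (t : ℝ) (l k : Fin n) :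
    HasSum (fun x : ℤ => Psi C a b (fun _ => 1) (fun k => -(k : ℤ)) n t (l + 1) x
      * stepDual γ a b n t k x) (if k = l then 1 else 0) := by
  obtain ⟨d, hd⟩ : ∃ d : ℕ, (n : ℤ) - l - 1 = d := ⟨n - l - 1, by omega⟩
  have hF : DifferentiableOn ℂ (fun z => expMonomial (l + 1) (b t) (a t) z * (1 - z) ^ d) {0}ᶜ :=
    (differentiableOn_expMonomial _ _ _).mul (by fun_prop)
  have hg : ContinuousOn (fun z => expMonomial n (-a t) (-b t) z * (z - 1) ^ ((k : ℤ) - n))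
      γ.trace :=
    (h0.continuousOn (differentiableOn_expMonomial _ _ _)).mul (h1.1.continuousOn_sub_zpow _)
  have hsum := γ.hasSum_laurentCoeff_mul_integral hF (continuousOn_inv₀.mono h0.trace_subset)
    (fun z hz => inv_ne_zero (h0.trace_subset hz)) hg
  rw [← (Equiv.neg ℤ).hasSum_iff] at hsum
  rw [integral_stepDual_pairing h1 h0 _ _ l k hd] at hsum
  refine hsum.congr_fun fun x => ?_
  simp only [Function.comp_apply, Equiv.neg_apply, inv_zpow', neg_neg]
  rw [Psi_one_step hC1.1, hd, ← hC0.integral_zpow_mul hF, stepDual]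
  congr 1
  · refine C.integral_congr fun z hz => ?_
    rw [← mul_assoc, zpow_mul_expMonomial (hC0.1.trace_subset hz), zpow_natCast]
    congr 2
    ring
  · refine γ.integral_congr fun z hz => ?_
    rw [← mul_assoc, zpow_mul_expMonomial (h0.trace_subset hz)]

theorem isDualFamily_stepDual {C γ : Loop} (hC0 : C.Includes 0) (hC1 : C.Excludes 1)
    (h1 : γ.Includes 1) (h0 : γ.Excludes 0) (a b : ℝ → ℝ) (n : ℕ) (t : ℝ) :
    IsDualFamily C a b (fun _ => 1) (fun k => -(k : ℤ)) n t (stepDual γ a b n t) := by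
  have hsum := hasSum_Psi_mul_stepDual hC0 hC1 h1 h0.1 a b n t
  exact ⟨hsum, span_range_eq_V_one (linearIndependent_of_biorthonormal hsum)
    (exists_polynomial_stepDual h0 h1.1 a b n t)⟩

/-! ### Conjugation of the kernels -/

theorem one_sub_zpow (z : ℂ) (m : ℤ) : (1 - z) ^ m = (-1) ^ m * (z - 1) ^ m := by
  rw [← mul_zpow, neg_one_mul, neg_sub]

section Kernel

variable {C Γ γ₀ γ₁ : Loop} (a b : ℝ → ℝ)

theorem Psi_one_step_eq_add (hC0 : C.Includes 0) (hC1 : C.Excludes 1) (h₀ : γ₀.Includes 0)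
    (h₀₁ : γ₀.Excludes 1) (h₁ : γ₁.Includes 1) (h₁₀ : γ₁.Excludes 0)
    (n : ℕ) (t : ℝ) (l : ℕ) (x : ℤ) :
    Psi C a b (fun _ => 1) (fun k => -(k : ℤ)) n t (l + 1) x =
      γ₀.integral (fun w => expMonomial (-x - n - 1) (a t) (b t) w * (w - 1) ^ ((n : ℤ) - l - 1))
      + γ₁.integral
        fun w => expMonomial (-x - n - 1) (a t) (b t) w * (w - 1) ^ ((n : ℤ) - l - 1) := by
  rw [Psi_one_step hC1.1]
  refine Loop.integral_mul_one_sub_zpow_eq_add hC0 hC1 h₀ h₀₁ h₁ h₁₀ _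
    (differentiableOn_expMonomial _ _ _) fun w hw => ?_
  rw [expMonomial_inv, zpow_mul_expMonomial hw]
  congr 1
  ring

theorem phi_one_eq_add (hC0 : C.Includes 0) (hC1 : C.Excludes 1) (h₀ : γ₀.Includes 0)
    (h₀₁ : γ₀.Excludes 1) (h₁ : γ₁.Includes 1) (h₁₀ : γ₁.Excludes 0)
    {p₁ p₂ : ℕ × ℝ} (hp : Prec p₁ p₂) (x₁ x₂ : ℤ) :
    phi C a b (fun _ => 1) p₁ x₁ p₂ x₂ =
      γ₀.integral (fun w => expMonomial (x₂ - x₁ - 1 + (p₂.1 - p₁.1))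
        (a p₁.2 - a p₂.2) (b p₁.2 - b p₂.2) w * (w - 1) ^ ((p₁.1 : ℤ) - p₂.1))
      + γ₁.integral (fun w => expMonomial (x₂ - x₁ - 1 + (p₂.1 - p₁.1))
        (a p₁.2 - a p₂.2) (b p₁.2 - b p₂.2) w * (w - 1) ^ ((p₁.1 : ℤ) - p₂.1)) := by
  have hcard : ((Finset.Icc (p₁.1 + 1) p₂.1).card : ℤ) = -((p₁.1 : ℤ) - p₂.1) := by
    have hle : p₁.1 ≤ p₂.1 := hp.1
    rw [Nat.card_Icc]
    omega
  rw [phi, if_pos hp, ← Loop.integral_mul_one_sub_zpow_eq_add hC0 hC1 h₀ h₀₁ h₁ h₁₀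
    (f := expMonomial (-(x₂ - x₁ + 1)) (b p₁.2 - b p₂.2) (a p₁.2 - a p₂.2))]
  · refine C.integral_congr fun z _ => ?_
    simp only [Complex.ofReal_one, one_mul, Finset.prod_const]
    rw [← zpow_natCast, hcard, zpow_neg (1 - z), div_inv_eq_mul, expMonomial, zpow_neg,
      ← Complex.exp_add, one_div, add_comm (_ / z), mul_assoc]
  · exact differentiableOn_expMonomial _ _ _
  · intro w hw
    rw [expMonomial_inv, zpow_mul_expMonomial hw]
    congr 1
    ring

theorem stepKernel_single_integral (h₀ : γ₀.Includes 0) (h₀₁ : γ₀.Excludes 1)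
    (hΓ0 : Γ.Includes 0) (hΓ1 : Γ.Excludes 1) (p₁ p₂ : ℕ × ℝ) (x₁ x₂ : ℤ) :
    (Γ.integral fun w => 1 / w ^ (x₁ - x₂ + 1) * (w / (1 - w)) ^ ((p₂.1 : ℤ) - p₁.1)
        * (Complex.exp (a p₁.2 * w + b p₁.2 / w) / Complex.exp (a p₂.2 * w + b p₂.2 / w)))
      = (-1) ^ ((p₁.1 : ℤ) - p₂.1) * γ₀.integral fun w =>
        expMonomial (x₂ - x₁ - 1 + (p₂.1 - p₁.1)) (a p₁.2 - a p₂.2) (b p₁.2 - b p₂.2) w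
          * (w - 1) ^ ((p₁.1 : ℤ) - p₂.1) := by
  rw [← Loop.integral_mul_sub_zpow_eq_of_includes hΓ0 hΓ1 h₀ h₀₁ one_ne_zero
    (differentiableOn_expMonomial _ _ _), ← Γ.integral_const_mul]
  refine Γ.integral_congr fun w hw => ?_
  have hw0 : w ≠ 0 := hΓ0.1.trace_subset hw
  have hpow : (w / (1 - w)) ^ ((p₂.1 : ℤ) - p₁.1)
      = w ^ ((p₂.1 : ℤ) - p₁.1) * ((-1) ^ ((p₁.1 : ℤ) - p₂.1) * (w - 1) ^ ((p₁.1 : ℤ) - p₂.1)) := by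
    rw [div_zpow, div_eq_mul_inv, ← zpow_neg, neg_sub, one_sub_zpow]
  have hexp : (a p₁.2 * w + b p₁.2 / w - (a p₂.2 * w + b p₂.2 / w) : ℂ)
      = (a p₁.2 - a p₂.2) * w + (b p₁.2 - b p₂.2) / w := by ring
  have hx : x₂ - x₁ - 1 = -(x₁ - x₂ + 1) := by ring
  rw [hpow, ← Complex.exp_sub, hexp, expMonomial, hx, zpow_add₀ hw0 (-_), zpow_neg, one_div]
  ring

theorem stepKernel_inner_integral (h₁ : γ₁.Includes 1) (h₁₀ : γ₁.Excludes 0) {w : ℂ}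
    (hw : γ₁.Excludes w) (hw0 : w ≠ 0) (hw1 : w ≠ 1) (p₁ p₂ : ℕ × ℝ) (x₁ x₂ : ℤ) :
    (γ₁.integral fun z =>
      Complex.exp (b p₁.2 / w + a p₁.2 * w) / Complex.exp (b p₂.2 / z + a p₂.2 * z)
        * ((1 - w) ^ p₁.1 / w ^ (x₁ + p₁.1 + 1))
        * (z ^ (x₂ + p₂.1) / (1 - z) ^ p₂.1)
        * (1 / (w - z)))
      = (-1) ^ ((p₁.1 : ℤ) - p₂.1) * ∑ k : Fin p₂.1, stepDual γ₁ a b p₂.1 p₂.2 k x₂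
        * (expMonomial (-x₁ - p₁.1 - 1) (a p₁.2) (b p₁.2) w
          * (w - 1) ^ ((p₁.1 : ℤ) - (k : ℕ) - 1)) := by
  have hsum := Loop.integral_mul_sub_zpow_mul_inv_sub h₁₀ h₁.1 hw hw0 hw1
    (differentiableOn_expMonomial (x₂ + p₂.1) (-a p₂.2) (-b p₂.2)) p₂.1
  rw [← Fin.sum_univ_eq_sum_range (fun k => (w - 1) ^ (-(k : ℤ) - 1) * γ₁.integral fun z =>
    expMonomial (x₂ + p₂.1) (-a p₂.2) (-b p₂.2) z * (z - 1) ^ ((k : ℤ) - p₂.1))] at hsum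
  trans (-1) ^ ((p₁.1 : ℤ) - p₂.1)
    * (expMonomial (-x₁ - p₁.1 - 1) (a p₁.2) (b p₁.2) w * (w - 1) ^ p₁.1)
    * γ₁.integral fun z =>
      expMonomial (x₂ + p₂.1) (-a p₂.2) (-b p₂.2) z * (z - 1) ^ (-(p₂.1 : ℤ)) * (w - z)⁻¹
  · rw [← γ₁.integral_const_mul]
    refine γ₁.integral_congr fun z _ => ?_
    have hz : ((1 - z) ^ p₂.1)⁻¹ = (-1) ^ (-(p₂.1 : ℤ)) * (z - 1) ^ (-(p₂.1 : ℤ)) := by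
      rw [← one_sub_zpow, zpow_neg, zpow_natCast]
    have hw' : (1 - w) ^ p₁.1 = (-1) ^ p₁.1 * (w - 1) ^ p₁.1 := by
      exact_mod_cast one_sub_zpow w p₁.1
    have hx : -x₁ - p₁.1 - 1 = -(x₁ + p₁.1 + 1) := by ring
    have hexp : (-a p₂.2 * z + -b p₂.2 / z : ℂ) = -(b p₂.2 / z + a p₂.2 * z) := by ring
    rw [div_eq_mul_inv _ ((1 - z) ^ p₂.1), hz, hw', expMonomial, expMonomial, hx, hexp,
      Complex.exp_neg, zpow_neg w, add_comm (_ / w), sub_eq_add_neg (p₁.1 : ℤ),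
      zpow_add₀ (neg_ne_zero.2 one_ne_zero : (-1 : ℂ) ≠ 0), zpow_natCast]
    ring
  · rw [hsum, mul_assoc, Finset.mul_sum]
    congr 1
    refine Finset.sum_congr rfl fun k _ => ?_
    have hk : (p₁.1 : ℤ) - (k : ℕ) - 1 = p₁.1 + (-(k : ℕ) - 1) := by ring
    rw [stepDual, hk, zpow_add₀ (sub_ne_zero.2 hw1), zpow_natCast]
    ring

theorem stepKernel_double_integral (h₀ : γ₀.Avoids 0) (h₀₁ : γ₀.Avoids 1)
    (h₁ : γ₁.Includes 1) (h₁₀ : γ₁.Excludes 0)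
    (h₁w : ∀ s ∈ Icc (0 : ℝ) 1, γ₁.Excludes (γ₀.path s)) (p₁ p₂ : ℕ × ℝ) (x₁ x₂ : ℤ) :
    (γ₀.integral fun w => γ₁.integral fun z =>
      Complex.exp (b p₁.2 / w + a p₁.2 * w) / Complex.exp (b p₂.2 / z + a p₂.2 * z)
        * ((1 - w) ^ p₁.1 / w ^ (x₁ + p₁.1 + 1))
        * (z ^ (x₂ + p₂.1) / (1 - z) ^ p₂.1)
        * (1 / (w - z)))
      = (-1) ^ ((p₁.1 : ℤ) - p₂.1) * ∑ k : Fin p₂.1, stepDual γ₁ a b p₂.1 p₂.2 k x₂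
        * γ₀.integral (fun w => expMonomial (-x₁ - p₁.1 - 1) (a p₁.2) (b p₁.2) w
          * (w - 1) ^ ((p₁.1 : ℤ) - (k : ℕ) - 1)) := by
  have hinner : ∀ w ∈ γ₀.trace, _ := fun w hw =>
    stepKernel_inner_integral a b h₁ h₁₀ (forall_mem_image.2 h₁w w hw) (h₀.trace_subset hw)
      (h₀₁.trace_subset hw) p₁ p₂ x₁ x₂
  rw [γ₀.integral_congr hinner, γ₀.integral_const_mul, γ₀.integral_finsetSum]
  · simp_rw [γ₀.integral_const_mul]
  · exact fun k _ => continuousOn_const.mul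
      ((h₀.continuousOn (differentiableOn_expMonomial _ _ _)).mul (h₀₁.continuousOn_sub_zpow _))

theorem sum_integral_mul_stepDual (h₁ : γ₁.Includes 1) (h₁₀ : γ₁.Excludes 0) (p₁ p₂ : ℕ × ℝ)
    (x₁ x₂ : ℤ) :
    ∑ k : Fin p₂.1, γ₁.integral (fun w => expMonomial (-x₁ - p₁.1 - 1) (a p₁.2) (b p₁.2) w
        * (w - 1) ^ ((p₁.1 : ℤ) - (k : ℕ) - 1)) * stepDual γ₁ a b p₂.1 p₂.2 k x₂
      = γ₁.integral fun w =>
        expMonomial (x₂ - x₁ - 1 + (p₂.1 - p₁.1)) (a p₁.2 - a p₂.2) (b p₁.2 - b p₂.2) w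
          * (w - 1) ^ ((p₁.1 : ℤ) - p₂.1) := by
  have hsum := Loop.sum_integral_mul_integral h₁₀ h₁ one_ne_zero
    (differentiableOn_expMonomial (-x₁ - p₁.1 - 1) (a p₁.2) (b p₁.2))
    (differentiableOn_expMonomial (x₂ + p₂.1) (-a p₂.2) (-b p₂.2)) p₁.1 p₂.1
  rw [← Fin.sum_univ_eq_sum_range (fun k => γ₁.integral _ * γ₁.integral _)] at hsum
  refine hsum.trans (γ₁.integral_congr fun w hw => ?_)
  rw [expMonomial_mul (h₁₀.1.trace_subset hw), ← sub_eq_add_neg, ← sub_eq_add_neg]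
  congr 2
  ring

theorem stepKernel_eq_mul_kernel (hC0 : C.Includes 0) (hC1 : C.Excludes 1) (h₀ : γ₀.Includes 0)
    (h₀₁ : γ₀.Excludes 1) (h₁ : γ₁.Includes 1) (h₁₀ : γ₁.Excludes 0)
    (hΓ0 : Γ.Includes 0) (hΓ1 : Γ.Excludes 1)
    (h₁w : ∀ s ∈ Icc (0 : ℝ) 1, γ₁.Excludes (γ₀.path s)) {p₁ p₂ : ℕ × ℝ}
    (hp : Prec p₁ p₂ ∨ p₂.1 ≤ p₁.1) (x₁ x₂ : ℤ) :
    stepKernel Γ γ₀ γ₁ a b p₁ x₁ p₂ x₂ = (-1 : ℂ) ^ ((p₁.1 : ℤ) - p₂.1)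
      * kernel C a b (fun _ => 1) (fun k => -(k : ℤ)) (stepDual γ₁ a b) p₁ x₁ p₂ x₂ := by
  rw [stepKernel, kernel, stepKernel_double_integral a b h₀.1 h₀₁.1 h₁ h₁₀ h₁w,
    stepKernel_single_integral a b h₀ h₀₁ hΓ0 hΓ1]
  simp_rw [Psi_one_step_eq_add a b hC0 hC1 h₀ h₀₁ h₁ h₁₀, add_mul, Finset.sum_add_distrib,
    sum_integral_mul_stepDual a b h₁ h₁₀, mul_comm (stepDual γ₁ a b _ _ _ _)]
  by_cases h : Prec p₁ p₂
  · rw [if_pos h, phi_one_eq_add a b hC0 hC1 h₀ h₀₁ h₁ h₁₀ h]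
    ring
  · obtain ⟨d, hd⟩ : ∃ d : ℕ, (p₁.1 : ℤ) - p₂.1 = d :=
      ⟨p₁.1 - p₂.1, by have := hp.resolve_left h; omega⟩
    have hvanish : γ₁.integral (fun w => expMonomial (x₂ - x₁ - 1 + (p₂.1 - p₁.1))
        (a p₁.2 - a p₂.2) (b p₁.2 - b p₂.2) w * (w - 1) ^ ((p₁.1 : ℤ) - p₂.1)) = 0 := by
      simp only [hd, zpow_natCast]
      exact h₁₀.integral_eq_zero ((differentiableOn_expMonomial _ _ _).mul (by fun_prop))
    rw [if_neg h, phi, if_neg h, hvanish]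
    ring

end Kernel

theorem det_of_div_mul {ι K : Type*} [Fintype ι] [DecidableEq ι] [Field K] {u : ι → K}
    (hu : ∀ i, u i ≠ 0) (M : Matrix ι ι K) :
    (Matrix.of fun i j => u i / u j * M i j).det = M.det := by
  have hM : (Matrix.of fun i j => u i / u j * M i j)
      = Matrix.of fun i j => u i * (Matrix.of fun i j => (u j)⁻¹ * M i j) i j := by
    ext i j
    simp only [Matrix.of_apply, div_eq_mul_inv, mul_assoc]
  rw [hM, Matrix.det_mul_column, Matrix.det_mul_row, ← mul_assoc, ← Finset.prod_mul_distrib,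
    Finset.prod_eq_one fun i _ => mul_inv_cancel₀ (hu i), one_mul]

theorem IsSpaceLike.prec_or_le {m : ℕ} {p : Fin m → ℕ × ℝ} (hp : IsSpaceLike p) (i j : Fin m) :
    Prec (p i) (p j) ∨ (p j).1 ≤ (p i).1 := by
  rcases lt_trichotomy i j with h | rfl | h
  · exact Or.inl (hp i j h)
  · exact Or.inr le_rfl
  · exact Or.inr (hp j i h).1

end PushASEP

end

/-- Uniform rates `v_k = 1` and step initial condition `y_k = -k`. The functions `Φ` entering the
PushASEP kernel exist and are unique, and along every space-like path the kernel is the explicit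
one, up to the conjugation by `(-1)^{n₁-n₂}`, which leaves all correlation determinants
unchanged. -/
theorem proposition3p3 (a b : ℝ → ℝ)
    -- contour used in the definition of the general kernel: around 0, pole 1 / v_j = 1 outside
    (C : PushASEP.Loop) (hC0 : C.Includes 0) (hC1 : C.Excludes 1)
    -- contour of the single integral
    (Γ : PushASEP.Loop) (hΓ0 : Γ.Includes 0) (hΓ1 : Γ.Excludes 1)
    -- contours of the double integral
    (Γ₀ Γ₁ : PushASEP.Loop)
    (h₀ : Γ₀.Includes 0) (h₀₁ : Γ₀.Excludes 1)
    (h₀z : ∀ s ∈ Set.Icc (0 : ℝ) 1, Γ₀.Excludes (Γ₁.path s))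
    (h₁ : Γ₁.Includes 1) (h₁₀ : Γ₁.Excludes 0)
    (h₁w : ∀ s ∈ Set.Icc (0 : ℝ) 1, Γ₁.Excludes (Γ₀.path s)) :
    (∀ (n : ℕ) (t : ℝ), ∃! Φ : Fin n → ℤ → ℂ,
      PushASEP.IsDualFamily C a b (fun _ => 1) (fun k => -(k : ℤ)) n t Φ) ∧
    ∀ Φ : (n : ℕ) → ℝ → Fin n → ℤ → ℂ,
      (∀ (n : ℕ) (t : ℝ),
        PushASEP.IsDualFamily C a b (fun _ => 1) (fun k => -(k : ℤ)) n t (Φ n t)) →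
      ∀ (m : ℕ) (p : Fin m → ℕ × ℝ), PushASEP.IsSpaceLike p →
        (∀ (i j : Fin m) (x₁ x₂ : ℤ),
          PushASEP.stepKernel Γ Γ₀ Γ₁ a b (p i) x₁ (p j) x₂
            = (-1 : ℂ) ^ (((p i).1 : ℤ) - ((p j).1 : ℤ))
              * PushASEP.kernel C a b (fun _ => 1) (fun k => -(k : ℤ)) Φ (p i) x₁ (p j) x₂) ∧
        (∀ (r : ℕ) (q : Fin r → Fin m × ℤ),
          (Matrix.of fun α β : Fin r =>
              PushASEP.stepKernel Γ Γ₀ Γ₁ a b (p (q α).1) (q α).2 (p (q β).1) (q β).2).det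
            = (Matrix.of fun α β : Fin r =>
              PushASEP.kernel C a b (fun _ => 1) (fun k => -(k : ℤ)) Φ
                (p (q α).1) (q α).2 (p (q β).1) (q β).2).det) := by
  have hdual := PushASEP.isDualFamily_stepDual hC0 hC1 h₁ h₁₀ a b
  refine ⟨fun n t => ⟨_, hdual n t, fun Φ hΦ => (hdual n t).unique hΦ⟩, fun Φ hΦ m p hp => ?_⟩
  obtain rfl : Φ = PushASEP.stepDual Γ₁ a b := funext₂ fun n t => (hdual n t).unique (hΦ n t)
  have hconj := fun i j => PushASEP.stepKernel_eq_mul_kernel a b hC0 hC1 h₀ h₀₁ h₁ h₁₀ hΓ0 hΓ1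
    h₁w (hp.prec_or_le i j)
  refine ⟨hconj, fun r q => ?_⟩
  have hsign : (-1 : ℂ) ≠ 0 := neg_ne_zero.2 one_ne_zero
  simp_rw [hconj, zpow_sub₀ hsign]
  exact PushASEP.det_of_div_mul (fun α => zpow_ne_zero ((p (q α).1).1 : ℤ) hsign) (.of _)
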